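/- Let $d,l\ge 1$ and $\Omega=(0,1)^d$. Let $\|\cdot\|$ and $\langle\cdot,\cdot\rangle$ be the Euclidean (for matrices: Frobenius) norm and inner product, let $\mathcal B_r(0)$ be the ball of radius $r$ around $0$ in $\mathbb R^{d\times l}$, and let $\Delta_l=\{a\in\mathbb R^l\mid a\ge 0,\ \sum_{i=1}^l a_i=1\}$. For $u\in L^1(\Omega)^l$ put $$\mathrm{TV}(u)=\sup\Big\{\int_\Omega\langle u,\operatorname{Div}v\rangle\,dx \;\Big|\; v\in C_c^\infty(\Omega)^{d\times l},\ \|v(x)\|\le 1\ \forall x\in\Omega\Big\},\qquad \operatorname{Div}v=(\operatorname{div}v^1,\dots,\operatorname{div}v^l)^\top,$$ where $v^1,\dots,v^l$ are the columns of $v$, and let $\mathrm{BV}(\Omega)^l=\{u\in L^1(\Omega)^l\mid \mathrm{TV}(u)<\infty\}$. For $u\in \mathrm{BV}(\Omega)^l$ the distributional gradient $Du$ is a finite $\mathbb R^{d\times l}$-valued Radon measure on $\Omega$; let $|Du|$ be its total variation measure and $Du/|Du|$ the density of $Du$ with respect to $|Du|$. Let $\emptyset\ne\mathcal D_{\mathrm{loc}}\subseteq\mathbb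 R^{d\times l}$ be closed and convex with $$\mathcal B_{\rho_l}(0)\cap\{(v^1|\cdots|v^l)\in\mathbb R^{d\times l}\mid v^1+\cdots+v^l=0\}\;\subseteq\;\mathcal D_{\mathrm{loc}}\;\subseteq\;\mathcal B_{\rho_u}(0)$$ for some $0<\rho_l\le\rho_u$, let $\Psi(z)=\sup_{v\in\mathcal D_{\mathrm{loc}}}\langle z,v\rangle$, and let $s\in L^1(\Omega)^l$. Let $$\mathcal C=\{u\in \mathrm{BV}(\Omega)^l\mid u(x)\in\Delta_l\text{ for a.e. }x\in\Omega\},\qquad f(u)=\int_\Omega\langle u,s\rangle\,dx+\int_\Omega\Psi(Du),\qquad \int_\Omega\Psi(Du):=\int_\Omega\Psi\Big(\frac{Du}{|Du|}\Big)\,d|Du|.$$ Then the problem $\min_{u\in\mathcal C}f(u)$ has at least one minimizer, i.e. there is $u\in\mathcal C$ with $f(u)\le f(w)$ for all $w\in\mathcal C$. -/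

import Mathlib

open MeasureTheory
open scoped ContDiff

noncomputable section

namespace Labeling

/-- `ℝᵈ` with the Euclidean norm. -/
abbrev Space (d : ℕ) := EuclideanSpace ℝ (Fin d)

/-- `ℝˡ` with the Euclidean norm. -/
abbrev Labels (l : ℕ) := EuclideanSpace ℝ (Fin l)

/-- The matrices `ℝ^{d × l}` with the Frobenius norm and the elementwise inner product;
the entry in row `i` and column `j` of `A` is `A (i, j)`. -/
abbrev Mat (d l : ℕ) := EuclideanSpace ℝ (Fin d × Fin l)

/-- The image domain `Ω = (0, 1)ᵈ`. -/
def Omega (d : ℕ) : Set (Space d) := {x | ∀ i, 0 < x i ∧ x i < 1}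

/-- `v ∈ C_c^∞(Ω)^{d × l}`, extended by zero to the whole space. -/
structure IsTestField {d l : ℕ} (v : Space d → Mat d l) : Prop where
  smooth : ContDiff ℝ ∞ v
  compact : HasCompactSupport v
  supp : tsupport v ⊆ Omega d

/-- `Div v = (div v¹, …, div vˡ)`, the divergences of the columns of `v`. -/
def Div {d l : ℕ} (v : Space d → Mat d l) (x : Space d) : Labels l :=
  WithLp.toLp 2 fun j => ∑ i, fderiv ℝ v x (EuclideanSpace.single i 1) (i, j)

/-- The total variation
`TV(u) = sup { ∫_Ω ⟨u, Div v⟩ dx | v ∈ C_c^∞(Ω)^{d × l}, ‖v(x)‖ ≤ 1 for all x ∈ Ω }`. -/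
def TV {d l : ℕ} (u : Space d → Labels l) : EReal :=
  ⨆ v : {v : Space d → Mat d l // IsTestField v ∧ ∀ x ∈ Omega d, ‖v x‖ ≤ 1},
    ((∫ x in Omega d, inner ℝ (u x) (Div v.1 x) : ℝ) : EReal)

/-- `BV(Ω)ˡ`: the functions `u ∈ L¹(Ω)ˡ` with `TV(u) < ∞`. -/
def BV (d l : ℕ) : Set (Space d → Labels l) :=
  {u | MemLp u 1 (volume.restrict (Omega d)) ∧ TV u < ⊤}

/-- The `ℝ^{d × l}`-valued measure `σ m` on `Ω` is the distributional gradient `Du` of `u`, written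
in polar form: `m` is a finite positive measure on `Ω` and `‖σ‖ = 1` holds `m`-almost everywhere, so
that `m = |Du|` is the total variation measure and `σ = Du / |Du|` the density of `Du` with respect
to `|Du|`. The pair is unique up to changing `σ` on an `m`-null set. -/
structure IsPolarGradient {d l : ℕ} (u : Space d → Labels l)
    (m : Measure (Space d)) (σ : Space d → Mat d l) : Prop where
  finite : IsFiniteMeasure m
  concentrated : m (Omega d)ᶜ = 0
  measurable : Measurable σ
  norm_eq_one : ∀ᵐ x ∂m, ‖σ x‖ = 1
  integral_by_parts : ∀ v : Space d → Mat d l, IsTestField v →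
    ∫ x in Omega d, inner ℝ (u x) (Div v x) = - ∫ x, inner ℝ (v x) (σ x) ∂m

open Classical in
/-- The pair `(|Du|, Du / |Du|)`. It exists for every `u ∈ BV(Ω)ˡ`; the value `(0, 0)` is used
only for functions `u` whose distributional gradient is not a finite measure. -/
def polarGradient {d l : ℕ} (u : Space d → Labels l) :
    Measure (Space d) × (Space d → Mat d l) :=
  if h : ∃ p : Measure (Space d) × (Space d → Mat d l), IsPolarGradient u p.1 p.2
  then h.choose else (0, 0)

/-- The support function `Ψ(z) = sup { ⟨z, v⟩ | v ∈ D }` (of a nonempty bounded set `D`). -/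
def supportFun {d l : ℕ} (D : Set (Mat d l)) (z : Mat d l) : ℝ :=
  sSup ((fun v => inner ℝ z v) '' D)

/-- The regularizer `J(u) = ∫_Ω Ψ(Du) = ∫_Ω Ψ(Du / |Du|) d|Du|`, where `Ψ` is the (positively
homogeneous) support function of `D`. -/
def regularizer {d l : ℕ} (D : Set (Mat d l)) (u : Space d → Labels l) : ℝ :=
  ∫ x, supportFun D ((polarGradient u).2 x) ∂(polarGradient u).1

/-- The objective `f(u) = ∫_Ω ⟨u, s⟩ dx + ∫_Ω Ψ(Du)`. -/
def objective {d l : ℕ} (D : Set (Mat d l)) (s : Space d → Labels l)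
    (u : Space d → Labels l) : ℝ :=
  (∫ x in Omega d, inner ℝ (u x) (s x)) + regularizer D u

/-- The relaxed feasible set `C = { u ∈ BV(Ω)ˡ | u(x) ∈ Δ_l for a.e. x ∈ Ω }`. -/
def feasible (d l : ℕ) : Set (Space d → Labels l) :=
  {u | u ∈ BV d l ∧ ∀ᵐ x ∂(volume.restrict (Omega d)), (u x).ofLp ∈ stdSimplex ℝ (Fin l)}

end Labeling

end

namespace Labeling

open Filter Topology CompactlySupported

variable {d l : ℕ}

theorem isOpen_Omega (d : ℕ) : IsOpen (Omega d) := by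
  have : Omega d = ⋂ i, ({x : Space d | 0 < x i} ∩ {x : Space d | x i < 1}) := by
    ext x; simp [Omega]
  rw [this]
  refine isOpen_iInter_of_finite fun i => ?_
  exact (isOpen_lt (by fun_prop) (by fun_prop)).inter (isOpen_lt (by fun_prop) (by fun_prop))

theorem Omega_subset_closedBall (d : ℕ) : Omega d ⊆ Metric.closedBall 0 (√d) := by
  intro x hx
  rw [mem_closedBall_zero_iff, EuclideanSpace.norm_eq]
  refine Real.sqrt_le_sqrt ?_
  calc ∑ i, ‖x i‖ ^ 2 ≤ ∑ i : Fin d, (1 : ℝ) := by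
        refine Finset.sum_le_sum fun i _ => ?_
        have h := hx i
        rw [Real.norm_eq_abs, sq_abs]
        nlinarith
    _ = d := by simp

theorem measure_Omega_lt_top (μ : Measure (Space d)) [IsFiniteMeasureOnCompacts μ] :
    μ (Omega d) < ⊤ :=
  (measure_mono (Omega_subset_closedBall d)).trans_lt (isCompact_closedBall _ _).measure_lt_top

instance isFiniteMeasure_restrict_Omega (μ : Measure (Space d)) [IsFiniteMeasureOnCompacts μ] :
    IsFiniteMeasure (μ.restrict (Omega d)) :=
  ⟨by simpa using measure_Omega_lt_top μ⟩

theorem integrable_inner_of_memLp {α F : Type*} [MeasurableSpace α] {μ : Measure α}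
    [NormedAddCommGroup F] [InnerProductSpace ℝ F] (p q : ENNReal) [ENNReal.HolderTriple p q 1]
    {f g : α → F} (hf : MemLp f p μ) (hg : MemLp g q μ) :
    Integrable (fun x => inner ℝ (f x) (g x)) μ :=
  memLp_one_iff_integrable.mp ((innerSL ℝ).memLp_of_bilin 1 hf hg)

/-! ### Test fields -/

theorem IsTestField.eq_zero {v : Space d → Mat d l} (hv : IsTestField v) {x : Space d}
    (hx : x ∉ Omega d) : v x = 0 :=
  image_eq_zero_of_notMem_tsupport fun h => hx (hv.supp h)

theorem IsTestField.differentiable {v : Space d → Mat d l} (hv : IsTestField v) :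
    Differentiable ℝ v :=
  hv.smooth.differentiable (by simp)

theorem IsTestField.zero : IsTestField (0 : Space d → Mat d l) where
  smooth := contDiff_const
  compact := HasCompactSupport.zero
  supp := by simp [tsupport]

theorem IsTestField.add {v w : Space d → Mat d l} (hv : IsTestField v) (hw : IsTestField w) :
    IsTestField (v + w) where
  smooth := hv.smooth.add hw.smooth
  compact := hv.compact.add hw.compact
  supp := (tsupport_add v w).trans (Set.union_subset hv.supp hw.supp)

theorem IsTestField.clm_comp {v : Space d → Mat d l} (hv : IsTestField v)
    (A : Mat d l →L[ℝ] Mat d l) : IsTestField (fun x => A (v x)) where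
  smooth := A.contDiff.comp hv.smooth
  compact := hv.compact.comp_left (g := A) A.map_zero
  supp := (tsupport_comp_subset A.map_zero v).trans hv.supp

theorem IsTestField.smul {v : Space d → Mat d l} (hv : IsTestField v) (c : ℝ) :
    IsTestField (c • v) :=
  hv.clm_comp (c • ContinuousLinearMap.id ℝ _)

/-- The vector space of test fields. -/
def testFields (d l : ℕ) : Submodule ℝ (Space d → Mat d l) where
  carrier := {v | IsTestField v}
  zero_mem' := IsTestField.zero
  add_mem' := IsTestField.add
  smul_mem' c _ hv := IsTestField.smul hv c

/-! ### The divergence -/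

theorem Div_add {v w : Space d → Mat d l} (hv : IsTestField v) (hw : IsTestField w)
    (x : Space d) : Div (v + w) x = Div v x + Div w x := by
  ext j
  simp [Div, fderiv_add (hv.differentiable x) (hw.differentiable x), Finset.sum_add_distrib]

theorem Div_clm_comp {v : Space d → Mat d l} (hv : IsTestField v)
    (A : Mat d l →L[ℝ] Mat d l) (x : Space d) (j : Fin l) :
    Div (fun x => A (v x)) x j =
      ∑ i, A (fderiv ℝ v x (EuclideanSpace.single i 1)) (i, j) := by
  have h : fderiv ℝ (fun x => A (v x)) x = A.comp (fderiv ℝ v x) :=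
    (A.hasFDerivAt.comp x (hv.differentiable x).hasFDerivAt).fderiv
  simp [Div, h]

theorem Div_smul {v : Space d → Mat d l} (hv : IsTestField v) (c : ℝ)
    (x : Space d) : Div (c • v) x = c • Div v x := by
  ext j
  have := Div_clm_comp hv (c • ContinuousLinearMap.id ℝ _) x j
  simp only [smul_apply, ContinuousLinearMap.id_apply] at this
  change Div (fun x => c • v x) x j = _
  rw [this]
  simp [Div, Finset.mul_sum]

theorem continuous_Div {v : Space d → Mat d l} (hv : IsTestField v) : Continuous (Div v) := by
  have h := hv.smooth.continuous_fderiv (by simp)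
  unfold Div
  fun_prop

theorem hasCompactSupport_Div {v : Space d → Mat d l} (hv : IsTestField v) :
    HasCompactSupport (Div v) := by
  refine (hv.compact.fderiv ℝ).mono fun x hx => ?_
  contrapose! hx
  simp only [Function.mem_support, not_not] at hx ⊢
  ext j
  simp [Div, hx]

theorem memLp_Div {v : Space d → Mat d l} (hv : IsTestField v) (p : ENNReal) :
    MemLp (Div v) p (volume.restrict (Omega d)) :=
  ((continuous_Div hv).memLp_of_hasCompactSupport (hasCompactSupport_Div hv)).restrict _

theorem integrable_inner_Div {u : Space d → Labels l}
    (hu : MemLp u 1 (volume.restrict (Omega d))) {v : Space d → Mat d l} (hv : IsTestField v) :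
    Integrable (fun x => inner ℝ (u x) (Div v x)) (volume.restrict (Omega d)) :=
  integrable_inner_of_memLp 1 ⊤ hu (memLp_Div hv ⊤)

theorem integrable_fderiv_apply {v : Space d → Mat d l} (hv : IsTestField v)
    (y : Space d) (k : Fin d × Fin l) : Integrable (fun x => fderiv ℝ v x y k) volume := by
  have hc : Continuous fun x => fderiv ℝ v x y k := by
    have h := hv.smooth.continuous_fderiv (by simp)
    fun_prop
  refine hc.integrable_of_hasCompactSupport ((hv.compact.fderiv ℝ).mono fun x hx => ?_)
  contrapose! hx
  simp only [Function.mem_support, not_not] at hx ⊢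
  simp [hx]

theorem integral_fderiv_apply_eq_zero {v : Space d → Mat d l} (hv : IsTestField v)
    (y : Space d) (k : Fin d × Fin l) : ∫ x in Omega d, fderiv ℝ v x y k = 0 := by
  have hd : ∀ x, fderiv ℝ (fun x => v x k) x y = fderiv ℝ v x y k := fun x => by
    have := ((EuclideanSpace.proj (𝕜 := ℝ) k).hasFDerivAt.comp x
      (hv.differentiable x).hasFDerivAt).fderiv
    have h2 := congrArg (fun T => T y) this
    simpa [Function.comp_def] using h2
  have hvk : Continuous fun x => v x k := by
    have := hv.smooth.continuous
    fun_prop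
  have hvs : HasCompactSupport fun x => v x k :=
    hv.compact.comp_left (g := fun z : Mat d l => z k) rfl
  have hint := integrable_fderiv_apply hv y k
  rw [setIntegral_eq_integral_of_forall_compl_eq_zero]
  · have := integral_mul_fderiv_eq_neg_fderiv_mul_of_integrable (μ := volume) (f := fun _ => (1 : ℝ))
      (g := fun x => v x k) (v := y) (by simp) (by simpa [hd] using hint)
      (by simpa using hvk.integrable_of_hasCompactSupport hvs) (by simp)
      (fun x _ => by have := hv.differentiable x; fun_prop)
    simpa [hd] using this
  · intro x hx
    have : fderiv ℝ v x = 0 :=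
      image_eq_zero_of_notMem_tsupport fun h => hx (hv.supp (tsupport_fderiv_subset ℝ h))
    simp [this]

/-- Hahn-Banach and Riesz: a linear functional on continuous compactly supported fields that is
bounded for the supremum norm is dominated by the `L¹` norm of some measure. -/
theorem exists_measure_dominating {X F : Type*} [TopologicalSpace X] [T2Space X]
    [LocallyCompactSpace X] [MeasurableSpace X] [BorelSpace X] [NormedAddCommGroup F]
    [NormedSpace ℝ F] (V : Submodule ℝ (X → F))
    (hV : ∀ v ∈ V, Continuous v ∧ HasCompactSupport v) (L : V →ₗ[ℝ] ℝ) {C : ℝ}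
    (hL : ∀ (v : V) (t : ℝ), 0 ≤ t → (∀ x, ‖v.1 x‖ ≤ t) → L v ≤ C * t) :
    ∃ μ : Measure X, IsFiniteMeasureOnCompacts μ ∧ ∀ v : V, L v ≤ ∫ x, ‖v.1 x‖ ∂μ := by
  let S : C_c(X, ℝ) → Set ℝ := fun φ =>
    {r | ∃ (v : V) (t : ℝ), 0 ≤ t ∧ (∀ x, φ x + ‖v.1 x‖ ≤ t) ∧ r = C * t - L v}
  let N : C_c(X, ℝ) → ℝ := fun φ => sInf (S φ)
  have hbound : ∀ φ : C_c(X, ℝ), ∃ M : ℝ, 0 ≤ M ∧ ∀ x, |φ x| ≤ M := fun φ => by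
    obtain ⟨M, hM⟩ := φ.hasCompactSupport.exists_bound_of_continuous φ.continuous
    exact ⟨max M 0, le_max_right _ _, fun x => (hM x).trans (le_max_left _ _)⟩
  have hne : ∀ φ, (S φ).Nonempty := fun φ => by
    obtain ⟨M, hM0, hM⟩ := hbound φ
    exact ⟨_, 0, M, hM0, fun x => by simpa using (le_abs_self _).trans (hM x), rfl⟩
  have hbdd : ∀ φ, BddBelow (S φ) := fun φ => by
    obtain ⟨M, hM0, hM⟩ := hbound φ
    refine ⟨-(C * M), ?_⟩
    rintro _ ⟨v, t, ht, h, rfl⟩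
    have := hL v (t + M) (by positivity) fun x => by
      linarith [h x, neg_abs_le (φ x), hM x]
    linarith [mul_add C t M]
  have hsmul_le : ∀ c : ℝ, 0 < c → ∀ φ, N (c • φ) ≤ c * N φ := fun c hc φ => by
    rw [← div_le_iff₀' hc]
    refine le_csInf (hne φ) ?_
    rintro _ ⟨v, t, ht, h, rfl⟩
    rw [div_le_iff₀' hc]
    refine csInf_le (hbdd _) ⟨c • v, c * t, by positivity, fun x => ?_, ?_⟩
    · have := mul_le_mul_of_nonneg_left (h x) hc.le
      simpa [norm_smul, abs_of_pos hc, mul_add] using this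
    · simp; ring
  have hN_hom : ∀ c : ℝ, 0 < c → ∀ φ, N (c • φ) = c * N φ := fun c hc φ => by
    refine le_antisymm (hsmul_le c hc φ) ?_
    have := hsmul_le c⁻¹ (inv_pos.mpr hc) (c • φ)
    rw [inv_smul_smul₀ hc.ne'] at this
    rwa [← le_inv_mul_iff₀ hc]
  have hN_add : ∀ φ ψ, N (φ + ψ) ≤ N φ + N ψ := fun φ ψ => by
    rw [← sub_le_iff_le_add]
    refine le_csInf (hne φ) ?_
    rintro _ ⟨v, t, ht, h, rfl⟩
    rw [sub_le_comm]
    refine le_csInf (hne ψ) ?_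
    rintro _ ⟨w, s, hs, h', rfl⟩
    rw [sub_le_iff_le_add]
    refine csInf_le (hbdd _) ⟨v + w, t + s, by positivity, fun x => ?_, ?_⟩
    · have := norm_add_le (v.1 x) (w.1 x)
      simp only [CompactlySupportedContinuousMap.coe_add, Pi.add_apply, Submodule.coe_add]
      linarith [h x, h' x]
    · simp; ring
  have hN_zero : N 0 = 0 := by
    have := hN_hom 2 (by norm_num) 0
    rw [smul_zero] at this
    linarith
  obtain ⟨Λ, -, hΛ⟩ := exists_extension_of_le_sublinear (⊥ : C_c(X, ℝ) →ₗ.[ℝ] ℝ) N hN_hom hN_add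
    (fun φ => by
      have h0 : φ = 0 := Subtype.ext ((Submodule.mem_bot ℝ).mp φ.2)
      rw [h0, LinearPMap.map_zero, ZeroMemClass.coe_zero, hN_zero])
  have hΛ_nonneg : ∀ φ : C_c(X, ℝ), 0 ≤ φ → 0 ≤ Λ φ := fun φ hφ => by
    have h1 : N (-φ) ≤ 0 := csInf_le (hbdd _)
      ⟨0, 0, le_rfl, fun x => by simpa using hφ x, by simp⟩
    have h2 := hΛ (-φ)
    rw [map_neg] at h2
    linarith
  let Λ' : C_c(X, ℝ) →ₚ[ℝ] ℝ := PositiveLinearMap.mk₀ Λ hΛ_nonneg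
  refine ⟨RealRMK.rieszMeasure Λ', inferInstance, fun v => ?_⟩
  let φ : C_c(X, ℝ) := ⟨⟨fun x => ‖v.1 x‖, (hV v v.2).1.norm⟩, (hV v v.2).2.norm⟩
  have h := RealRMK.integral_rieszMeasure Λ' φ
  change ∫ x, ‖v.1 x‖ ∂_ = Λ φ at h
  rw [h]
  have h1 : N (-φ) ≤ - L v := csInf_le (hbdd _)
    ⟨v, 0, le_rfl, fun x => by simp [φ], by simp⟩
  have h2 := hΛ (-φ)
  rw [map_neg] at h2
  linarith

theorem integral_norm_le_mul_eLpNorm_two {α F : Type*} [MeasurableSpace α] {μ : Measure α}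
    [IsFiniteMeasure μ] [NormedAddCommGroup F] {f : α → F} (hf : MemLp f 2 μ) :
    ∫ x, ‖f x‖ ∂μ ≤ (μ Set.univ ^ (1 / 2 : ℝ)).toReal * (eLpNorm f 2 μ).toReal := by
  rw [integral_norm_eq_lintegral_enorm hf.1, ← eLpNorm_one_eq_lintegral_enorm, mul_comm,
    ← ENNReal.toReal_mul]
  refine ENNReal.toReal_mono (ENNReal.mul_ne_top hf.2.ne (by finiteness)) ?_
  refine (eLpNorm_le_eLpNorm_mul_rpow_measure_univ (p := 1) (q := 2) (by norm_num) hf.1).trans_eq ?_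
  norm_num

/-- A functional that is dominated by the `L¹` norm of a finite measure has a square integrable
density with respect to it. -/
theorem exists_density_of_le_integral_norm {α F : Type*} [MeasurableSpace α] {μ : Measure α}
    [IsFiniteMeasure μ] [NormedAddCommGroup F] [InnerProductSpace ℝ F] [CompleteSpace F]
    (V : Submodule ℝ (α → F)) (hV : ∀ v ∈ V, MemLp v 2 μ) (L : V →ₗ[ℝ] ℝ)
    (hL : ∀ v : V, L v ≤ ∫ x, ‖v.1 x‖ ∂μ) :
    ∃ g : α → F, StronglyMeasurable g ∧ MemLp g 2 μ ∧
      ∀ v : V, L v = ∫ x, inner ℝ (v.1 x) (g x) ∂μ := by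
  let T : V →ₗ[ℝ] Lp F 2 μ :=
    { toFun := fun v => (hV v v.2).toLp v.1
      map_add' := fun v w => rfl
      map_smul' := fun c v => rfl }
  obtain ⟨R, hR⟩ := T.rangeRestrict.exists_rightInverse_of_surjective T.range_rangeRestrict
  set K := (μ Set.univ ^ (1 / 2 : ℝ)).toReal
  have hLT : ∀ v, |L v| ≤ K * ‖T v‖ := by
    have key : ∀ v, L v ≤ K * ‖T v‖ := fun v => by
      refine ((hL v).trans (integral_norm_le_mul_eLpNorm_two (hV v v.2))).trans_eq ?_
      rw [show ‖T v‖ = _ from Lp.norm_toLp _ (hV v v.2)]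
    intro v
    refine abs_le.mpr ⟨?_, key v⟩
    have := key (-v)
    rw [map_neg, map_neg, norm_neg] at this
    linarith
  have hTR : ∀ y : T.range, T (R y) = y := fun y =>
    congrArg Subtype.val (LinearMap.congr_fun hR y)
  let G : StrongDual ℝ T.range := (L ∘ₗ R).mkContinuous K fun y => by
    have := hLT (R y)
    rwa [hTR] at this
  obtain ⟨G', hG', -⟩ := exists_extension_norm_eq T.range G
  let g : Lp F 2 μ := (InnerProductSpace.toDual ℝ (Lp F 2 μ)).symm G'
  refine ⟨g, Lp.stronglyMeasurable g, Lp.memLp g, fun v => ?_⟩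
  have h1 : L v = G' (T v) := by
    rw [show G' (T v) = L (R ⟨T v, v, rfl⟩) from hG' ⟨T v, v, rfl⟩]
    have := hLT (v - R ⟨T v, v, rfl⟩)
    rw [map_sub T, hTR, sub_self, norm_zero, mul_zero, map_sub] at this
    linarith [abs_nonpos_iff.mp this]
  rw [h1, ← InnerProductSpace.toDual_symm_apply (𝕜 := ℝ), real_inner_comm, L2.inner_def]
  refine integral_congr_ae ?_
  filter_upwards [(hV v v.2).coeFn_toLp] with x hx
  rw [← hx]
  rfl

/-- The functional `v ↦ -∫ ⟨u, Div v⟩` on the test fields. -/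
noncomputable def gradFunctional (u : Space d → Labels l)
    (hu : MemLp u 1 (volume.restrict (Omega d))) : testFields d l →ₗ[ℝ] ℝ where
  toFun v := -∫ x in Omega d, inner ℝ (u x) (Div v.1 x)
  map_add' v w := by
    have : ∀ x, inner ℝ (u x) (Div (v.1 + w.1) x) =
        inner ℝ (u x) (Div v.1 x) + inner ℝ (u x) (Div w.1 x) := fun x => by
      rw [Div_add v.2 w.2, inner_add_right]
    simp only [Submodule.coe_add, this]
    rw [integral_add (integrable_inner_Div hu v.2) (integrable_inner_Div hu w.2), neg_add]
  map_smul' c v := by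
    have : ∀ x, inner ℝ (u x) (Div (c • v.1) x) = c * inner ℝ (u x) (Div v.1 x) := fun x => by
      rw [Div_smul v.2, inner_smul_right]
    simp only [Submodule.coe_smul, this, integral_const_mul, smul_eq_mul, RingHom.id_apply,
      mul_neg]

theorem le_mul_of_TV_le {u : Space d → Labels l} (hu : MemLp u 1 (volume.restrict (Omega d)))
    {C : ℝ} (hTV : TV u ≤ C) {v : Space d → Mat d l} (hv : IsTestField v) {t : ℝ}
    (ht : 0 ≤ t) (h : ∀ x, ‖v x‖ ≤ t) :
    -∫ x in Omega d, inner ℝ (u x) (Div v x) ≤ C * t := by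
  rcases ht.eq_or_lt with rfl | ht
  · have : v = 0 := funext fun x => norm_le_zero_iff.mp (h x)
    have h2 := (gradFunctional u hu).map_zero
    change -∫ x in Omega d, inner ℝ (u x) (Div 0 x) = 0 at h2
    rw [this, h2, mul_zero]
  · have hw := hv.smul (-t⁻¹)
    have h1 := (le_iSup (fun v : {v : Space d → Mat d l //
        IsTestField v ∧ ∀ x ∈ Omega d, ‖v x‖ ≤ 1} =>
        ((∫ x in Omega d, inner ℝ (u x) (Div v.1 x) : ℝ) : EReal)) ⟨_, hw, fun x _ => by
          rw [Pi.smul_apply, norm_smul, norm_neg, norm_inv, Real.norm_of_nonneg ht.le,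
            inv_mul_le_iff₀ ht, mul_one]
          exact h x⟩).trans hTV
    have h2 := (gradFunctional u hu).map_smul (-t⁻¹) ⟨v, hv⟩
    change -∫ x in Omega d, inner ℝ (u x) (Div (-t⁻¹ • v) x) =
      -t⁻¹ * -∫ x in Omega d, inner ℝ (u x) (Div v x) at h2
    have h3 : ∫ x in Omega d, inner ℝ (u x) (Div (-t⁻¹ • v) x) ≤ C := by exact_mod_cast h1
    rw [← div_le_iff₀ ht, div_eq_inv_mul]
    linarith

/-- Every function of bounded variation has a polar gradient. -/
theorem exists_isPolarGradient {u : Space d → Labels l} (hu : u ∈ BV d l) :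
    ∃ p : Measure (Space d) × (Space d → Mat d l), IsPolarGradient u p.1 p.2 := by
  obtain ⟨hu1, hTV⟩ := hu
  obtain ⟨C, hC⟩ : ∃ C : ℝ, TV u ≤ C := by
    obtain ⟨C, h1, -⟩ := EReal.lt_iff_exists_real_btwn.mp hTV
    exact ⟨C, h1.le⟩
  obtain ⟨μ, hμ, hdom⟩ := exists_measure_dominating (testFields d l)
    (fun v hv => ⟨IsTestField.smooth hv |>.continuous, IsTestField.compact hv⟩)
    (gradFunctional u hu1) (C := C) (fun v t ht h => le_mul_of_TV_le hu1 hC v.2 ht h)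
  have hdom' : ∀ v : testFields d l,
      gradFunctional u hu1 v ≤ ∫ x in Omega d, ‖v.1 x‖ ∂μ := fun v => by
    rw [setIntegral_eq_integral_of_forall_compl_eq_zero]
    · exact hdom v
    · intro x hx
      rw [IsTestField.eq_zero v.2 hx, norm_zero]
  obtain ⟨g, hg, hg2, hLg⟩ := exists_density_of_le_integral_norm (testFields d l)
    (fun v hv => (IsTestField.smooth hv |>.continuous.memLp_of_hasCompactSupport
      (IsTestField.compact hv)).restrict _) (gradFunctional u hu1) hdom'
  have hgn : Measurable fun x => ‖g x‖₊ := hg.measurable.nnnorm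
  refine ⟨⟨(μ.restrict (Omega d)).withDensity fun x => (‖g x‖₊ : ENNReal),
    fun x => ‖g x‖⁻¹ • g x⟩, ?_, ?_, ?_, ?_, ?_⟩
  · refine isFiniteMeasure_withDensity ?_
    have := (hg2.integrable (by norm_num)).2
    exact this.ne
  · exact withDensity_absolutelyContinuous _ _
      (by rw [Measure.restrict_apply (isOpen_Omega d).measurableSet.compl]; simp)
  · exact (hg.measurable.norm.inv).smul hg.measurable
  · rw [ae_withDensity_iff hgn.coe_nnreal_ennreal]
    refine Eventually.of_forall fun x hx => ?_
    have : ‖g x‖ ≠ 0 := by simpa using hx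
    rw [norm_smul, norm_inv, norm_norm, inv_mul_cancel₀ this]
  · intro v hv
    have h1 := hLg ⟨v, hv⟩
    change -∫ x in Omega d, inner ℝ (u x) (Div v x) = _ at h1
    rw [eq_neg_iff_add_eq_zero, ← sub_eq_zero.mpr h1.symm,
      integral_withDensity_eq_integral_smul hgn, sub_neg_eq_add, add_comm]
    congr 1
    refine integral_congr_ae (Eventually.of_forall fun x => ?_)
    rcases eq_or_ne (g x) 0 with h0 | h0
    · simp [h0]
    · simp [inner_smul_right, NNReal.smul_def, h0]

theorem isPolarGradient_polarGradient {u : Space d → Labels l} (hu : u ∈ BV d l) :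
    IsPolarGradient u (polarGradient u).1 (polarGradient u).2 := by
  have h := exists_isPolarGradient hu
  rw [polarGradient, dif_pos h]
  exact h.choose_spec

/-- The metric projection onto a closed convex set. -/
theorem exists_projection {E : Type*} [NormedAddCommGroup E] [InnerProductSpace ℝ E]
    [CompleteSpace E] {D : Set E} (hne : D.Nonempty) (hcl : IsClosed D) (hconv : Convex ℝ D) :
    ∃ P : E → E, (∀ y, P y ∈ D) ∧ (∀ y, ∀ v ∈ D, inner ℝ (y - P y) (v - P y) ≤ 0) ∧
      ∀ y z, ‖P y - P z‖ ≤ ‖y - z‖ := by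
  choose P hPD hP using exists_norm_eq_iInf_of_complete_convex hne hcl.isComplete hconv
  have hP' : ∀ y, ∀ v ∈ D, inner ℝ (y - P y) (v - P y) ≤ 0 := fun y =>
    (norm_eq_iInf_iff_real_inner_le_zero hconv (hPD y)).mp (hP y)
  refine ⟨P, hPD, hP', fun y z => ?_⟩
  have h1 := hP' y _ (hPD z)
  have h2 := hP' z _ (hPD y)
  have h3 : ‖P y - P z‖ * ‖P y - P z‖ ≤ inner ℝ (y - z) (P y - P z) := by
    rw [← real_inner_self_eq_norm_mul_norm]
    have e : inner ℝ (y - z) (P y - P z) = inner ℝ (P y - P z) (P y - P z)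
        - inner ℝ (y - P y) (P z - P y) - inner ℝ (z - P z) (P y - P z) := by
      simp only [inner_sub_left, inner_sub_right]
      ring
    linarith
  have h4 := h3.trans (real_inner_le_norm _ _)
  rcases (norm_nonneg (P y - P z)).eq_or_lt with h | h
  · rw [← h]; exact norm_nonneg _
  · exact le_of_mul_le_mul_right h4 h

/-! ### The support function -/

section supportFun

variable {D : Set (Mat d l)} {ρ : ℝ}

theorem inner_le_of_subset_closedBall (hD : D ⊆ Metric.closedBall 0 ρ) (z : Mat d l)
    {v : Mat d l} (hv : v ∈ D) : inner ℝ z v ≤ ρ * ‖z‖ := by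
  have h : ‖v‖ ≤ ρ := by simpa using hD hv
  calc inner ℝ z v ≤ ‖z‖ * ‖v‖ := real_inner_le_norm _ _
    _ ≤ ‖z‖ * ρ := by gcongr
    _ = ρ * ‖z‖ := mul_comm _ _

theorem inner_le_supportFun (hD : D ⊆ Metric.closedBall 0 ρ) (z : Mat d l)
    {v : Mat d l} (hv : v ∈ D) : inner ℝ z v ≤ supportFun D z := by
  refine le_csSup ⟨ρ * ‖z‖, ?_⟩ ⟨v, hv, rfl⟩
  rintro _ ⟨w, hw, rfl⟩
  exact inner_le_of_subset_closedBall hD z hw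

theorem supportFun_le (hne : D.Nonempty) {z : Mat d l} {c : ℝ}
    (h : ∀ v ∈ D, inner ℝ z v ≤ c) : supportFun D z ≤ c := by
  refine csSup_le (hne.image _) ?_
  rintro _ ⟨w, hw, rfl⟩
  exact h w hw

theorem supportFun_nonneg (hD : D ⊆ Metric.closedBall 0 ρ) (h0 : (0 : Mat d l) ∈ D)
    (z : Mat d l) : 0 ≤ supportFun D z := by
  simpa using inner_le_supportFun hD z h0

theorem continuous_supportFun (hne : D.Nonempty) (hD : D ⊆ Metric.closedBall 0 ρ) :
    Continuous (supportFun D) := by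
  have hρ : 0 ≤ ρ := by
    obtain ⟨v, hv⟩ := hne
    exact dist_nonneg.trans (Metric.mem_closedBall.mp (hD hv))
  refine (LipschitzWith.of_le_add_mul ⟨ρ, hρ⟩ fun z y => ?_).continuous
  refine supportFun_le hne fun v hv => ?_
  have h1 := inner_le_supportFun hD y hv
  have h2 := inner_le_of_subset_closedBall hD (z - y) hv
  rw [inner_sub_left] at h2
  rw [dist_eq_norm]
  change _ ≤ _ + ρ * _
  linarith

theorem integrable_supportFun_comp (hne : D.Nonempty) (hD : D ⊆ Metric.closedBall 0 ρ)
    {m : Measure (Space d)} [IsFiniteMeasure m] {σ : Space d → Mat d l} (hσ : Measurable σ)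
    (h1 : ∀ᵐ x ∂m, ‖σ x‖ = 1) : Integrable (fun x => supportFun D (σ x)) m := by
  obtain ⟨v, hv⟩ := hne
  refine Integrable.of_bound
    ((continuous_supportFun ⟨v, hv⟩ hD).measurable.comp hσ).aestronglyMeasurable ρ ?_
  filter_upwards [h1] with x hx
  have hvρ : ‖v‖ ≤ ρ := by simpa using hD hv
  rw [Real.norm_eq_abs, abs_le]
  constructor
  · have h2 := inner_le_supportFun hD (σ x) hv
    have h3 := neg_le_of_abs_le (abs_real_inner_le_norm (σ x) v)
    rw [hx, one_mul] at h3
    linarith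
  · refine supportFun_le ⟨v, hv⟩ fun w hw => ?_
    simpa [hx] using inner_le_of_subset_closedBall hD (σ x) hw

end supportFun

/-! ### Approximation by test fields -/

/-- A continuous compactly supported field with values in a convex set containing `0` is a uniform
limit of test fields with values in this set. -/
theorem exists_isTestField_approx {D : Set (Mat d l)} (hconv : Convex ℝ D)
    (h0 : (0 : Mat d l) ∈ D) {v : Space d → Mat d l} (hv : Continuous v)
    (hvs : HasCompactSupport v) (hvΩ : tsupport v ⊆ Omega d) (hvD : ∀ x, v x ∈ D)
    {ε : ℝ} (hε : 0 < ε) :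
    ∃ w : Space d → Mat d l, IsTestField w ∧ (∀ x, w x ∈ D) ∧ ∀ x, ‖w x - v x‖ ≤ ε := by
  let t : Space d → Set (Mat d l) := fun x =>
    D ∩ Metric.closedBall (v x) ε ∩ {z | x ∉ tsupport v → z = 0}
  have ht : ∀ x, Convex ℝ (t x) := fun x => by
    refine (hconv.inter (convex_closedBall _ _)).inter ?_
    intro a ha b hb p q _ _ _ hx
    rw [ha hx, hb hx, smul_zero, smul_zero, add_zero]
  obtain ⟨g, hg⟩ := exists_contMDiffMap_forall_mem_convex_of_local_const
    (modelWithCornersSelf ℝ (Space d)) (n := (⊤ : ℕ∞)) ht (fun x => by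
      have hball : ∀ᶠ y in 𝓝 x, v x ∈ Metric.closedBall (v y) ε := by
        filter_upwards [hv.continuousAt.eventually (Metric.closedBall_mem_nhds (v x) hε)] with y hy
        rwa [Metric.mem_closedBall, dist_comm]
      rcases eq_or_ne (v x) 0 with hx | hx
      · refine ⟨0, ?_⟩
        filter_upwards [hball] with y hy
        exact ⟨⟨h0, hx ▸ hy⟩, fun _ => rfl⟩
      · refine ⟨v x, ?_⟩
        filter_upwards [hball, hv.continuousAt.eventually_ne hx] with y hy hy0
        exact ⟨⟨hvD x, hy⟩, fun h => absurd (image_eq_zero_of_notMem_tsupport h) hy0⟩)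
  have hsub : tsupport g ⊆ tsupport v := by
    refine closure_minimal (fun x hx => ?_) (isClosed_tsupport v)
    by_contra h
    exact hx ((hg x).2 h)
  exact ⟨g, ⟨g.contMDiff.contDiff, hvs.of_isClosed_subset (isClosed_tsupport g) hsub,
    hsub.trans hvΩ⟩, fun x => (hg x).1.1, fun x => by simpa [dist_eq_norm] using (hg x).1.2⟩

/-- Density of the continuous fields with compact support in an open set. -/
theorem exists_continuous_tsupport_subset_integral_sub_le {X F : Type*} [TopologicalSpace X]
    [T2Space X] [NormalSpace X] [LocallyCompactSpace X] [MeasurableSpace X] [BorelSpace X] [NormedAddCommGroup F]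
    [NormedSpace ℝ F] {m : Measure X} [IsFiniteMeasure m] [m.Regular] {U : Set X} (hU : IsOpen U)
    (hm : m Uᶜ = 0) {σ : X → F} (hσ : Integrable σ m) {C : ℝ} (hC : 0 ≤ C)
    (hσC : ∀ᵐ x ∂m, ‖σ x‖ ≤ C) {δ : ℝ} (hδ : 0 < δ) :
    ∃ τ : X → F, Continuous τ ∧ HasCompactSupport τ ∧ tsupport τ ⊆ U ∧ Integrable τ m ∧
      ∫ x, ‖σ x - τ x‖ ∂m ≤ δ := by
  have hδC : 0 < δ / 2 / (C + 1) := by positivity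
  obtain ⟨K, hKU, hK, hmK⟩ := hU.measurableSet.exists_isCompact_sdiff_lt (measure_ne_top m U)
    (ENNReal.ofReal_pos.mpr hδC).ne'
  obtain ⟨χ, hχ1, hχc, hχU, hχ01⟩ := exists_continuousMap_one_of_isCompact_subset_isOpen hK hU hKU
  obtain ⟨g, -, hgδ, hgc, hgi⟩ := hσ.exists_hasCompactSupport_integral_sub_le (half_pos hδ)
  have hsub : tsupport (fun x => χ x • g x) ⊆ tsupport χ := tsupport_smul_subset_left _ _
  have hi : Integrable (fun x => χ x • g x) m :=
    hgi.bdd_smul 1 χ.continuous.aestronglyMeasurable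
      (Eventually.of_forall fun x => by
        rw [Real.norm_of_nonneg (hχ01 x).1]; exact (hχ01 x).2)
  refine ⟨fun x => χ x • g x, by fun_prop, hχc.of_isClosed_subset (isClosed_tsupport _) hsub,
    hsub.trans hχU, hi, ?_⟩
  have hKm : MeasurableSet (U \ K) := hU.measurableSet.diff hK.measurableSet
  have hpt : ∀ᵐ x ∂m, ‖σ x - χ x • g x‖ ≤ ‖σ x - g x‖ + (U \ K).indicator (fun _ => C) x := by
    have hUae : ∀ᵐ x ∂m, x ∈ U := hm
    filter_upwards [hσC, hUae] with x hx hxU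
    by_cases hxK : x ∈ K
    · simp [hχ1 hxK, hxK]
    · rw [Set.indicator_of_mem (show x ∈ U \ K from ⟨hxU, hxK⟩)]
      have e : σ x - χ x • g x = χ x • (σ x - g x) + (1 - χ x) • σ x := by
        rw [smul_sub, sub_smul, one_smul]; abel
      obtain ⟨h0, h1⟩ := hχ01 x
      rw [e]
      refine (norm_add_le _ _).trans ?_
      rw [norm_smul, norm_smul, Real.norm_of_nonneg h0, Real.norm_of_nonneg (sub_nonneg.mpr h1)]
      refine add_le_add (mul_le_of_le_one_left (norm_nonneg _) h1) ?_
      exact (mul_le_of_le_one_left (norm_nonneg _) (by linarith)).trans hx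
  have hσg : Integrable (fun x => ‖σ x - g x‖) m := (hσ.sub hgi).norm
  calc ∫ x, ‖σ x - χ x • g x‖ ∂m
      ≤ ∫ x, (‖σ x - g x‖ + (U \ K).indicator (fun _ => C) x) ∂m :=
        integral_mono_ae (hσ.sub hi).norm
          (hσg.add ((integrable_const C).indicator hKm)) hpt
    _ = ∫ x, ‖σ x - g x‖ ∂m + m.real (U \ K) * C := by
        rw [integral_add hσg ((integrable_const C).indicator hKm),
          integral_indicator_const _ hKm, smul_eq_mul]
    _ ≤ δ / 2 + δ / 2 / (C + 1) * C := by
        refine add_le_add hgδ (mul_le_mul_of_nonneg_right ?_ hC)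
        refine ENNReal.toReal_le_of_le_ofReal hδC.le ?_
        exact hmK.le
    _ ≤ δ / 2 + δ / 2 := by
        gcongr
        rw [div_mul_eq_mul_div, div_le_iff₀ (by positivity)]
        nlinarith
    _ = δ := add_halves δ

/-! ### The dual description of the regularizer -/

theorem IsPolarGradient.neg_integral_le {D : Set (Mat d l)} {ρ : ℝ}
    (hD : D ⊆ Metric.closedBall 0 ρ) {u : Space d → Labels l}
    {m : Measure (Space d)} {σ : Space d → Mat d l} (h : IsPolarGradient u m σ)
    {v : Space d → Mat d l} (hv : IsTestField v) (hvD : ∀ x, v x ∈ D) :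
    -∫ x in Omega d, inner ℝ (u x) (Div v x) ≤ ∫ x, supportFun D (σ x) ∂m := by
  have := h.finite
  rw [h.integral_by_parts v hv, neg_neg]
  have hσ : MemLp σ ⊤ m := memLp_top_of_bound h.measurable.aestronglyMeasurable 1
    (h.norm_eq_one.mono fun x hx => hx.le)
  refine integral_mono (integrable_inner_of_memLp 1 ⊤
    (hv.smooth.continuous.memLp_of_hasCompactSupport hv.compact) hσ)
    (integrable_supportFun_comp ⟨_, hvD 0⟩ hD h.measurable h.norm_eq_one) fun x => ?_
  change inner ℝ (v x) (σ x) ≤ _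
  rw [real_inner_comm]
  exact inner_le_supportFun hD _ (hvD x)

theorem IsPolarGradient.integral_supportFun_le {D : Set (Mat d l)} {ρ : ℝ}
    (hcl : IsClosed D) (hconv : Convex ℝ D) (h0 : (0 : Mat d l) ∈ D)
    (hD : D ⊆ Metric.closedBall 0 ρ) {u : Space d → Labels l}
    {m : Measure (Space d)} {σ : Space d → Mat d l} (h : IsPolarGradient u m σ) {c : ℝ}
    (hc : ∀ v : Space d → Mat d l, IsTestField v → (∀ x, v x ∈ D) →
      -∫ x in Omega d, inner ℝ (u x) (Div v x) ≤ c) :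
    ∫ x, supportFun D (σ x) ∂m ≤ c := by
  have := h.finite
  have hσ : MemLp σ ⊤ m := memLp_top_of_bound h.measurable.aestronglyMeasurable 1
    (h.norm_eq_one.mono fun x hx => hx.le)
  have hσi : Integrable σ m := hσ.integrable (by simp)
  obtain ⟨P, hPD, hP, hPlip⟩ := exists_projection ⟨0, h0⟩ hcl hconv
  have hPc : Continuous P := by
    refine LipschitzWith.continuous (K := 1) (LipschitzWith.of_dist_le_mul fun y z => ?_)
    simpa [dist_eq_norm] using hPlip y z
  have hP0 : P 0 = 0 := by
    have := hP 0 0 h0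
    simpa using this
  set A : ℝ := (ρ * ρ + 1) * m.real Set.univ + 1
  have hA : 0 < A := add_pos_of_nonneg_of_pos
    (mul_nonneg (add_nonneg (mul_self_nonneg ρ) zero_le_one) measureReal_nonneg) one_pos
  refine le_of_forall_pos_le_add fun η hη => ?_
  set ε := η / A
  have hε : 0 < ε := div_pos hη hA
  obtain ⟨τ, hτc, hτs, hτΩ, hτi, hτ⟩ := exists_continuous_tsupport_subset_integral_sub_le
    (isOpen_Omega d) h.concentrated hσi zero_le_one (h.norm_eq_one.mono fun x hx => hx.le)
    (mul_pos hε hε)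
  have hQ0 : P (ε⁻¹ • (0 : Mat d l)) = 0 := by rw [smul_zero, hP0]
  obtain ⟨w, hw, hwD, hwε⟩ := exists_isTestField_approx hconv h0
    (v := fun x => P (ε⁻¹ • τ x)) (hPc.comp (by fun_prop))
    (hτs.comp_left (g := fun z => P (ε⁻¹ • z)) hQ0)
    ((tsupport_comp_subset (g := fun z => P (ε⁻¹ • z)) hQ0 τ).trans hτΩ) (fun x => hPD _) hε
  have hpt : ∀ᵐ x ∂m, supportFun D (σ x) ≤
      inner ℝ (w x) (σ x) + ε * (ρ * ρ + 1) + ε⁻¹ * ‖σ x - τ x‖ := by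
    filter_upwards [h.norm_eq_one] with x hx
    refine supportFun_le ⟨0, h0⟩ fun v hv => ?_
    set p := P (ε⁻¹ • σ x)
    have hpρ : ‖p‖ ≤ ρ := by simpa using hD (hPD (ε⁻¹ • σ x))
    have h1 : inner ℝ (σ x) v ≤ inner ℝ (σ x) p + ε * (ρ * ρ) := by
      have h2 := mul_le_mul_of_nonneg_left (hP (ε⁻¹ • σ x) v hv) hε.le
      have h3 : inner ℝ p v ≤ ρ * ρ := (inner_le_of_subset_closedBall hD p hv).trans
        (mul_le_mul_of_nonneg_left hpρ ((norm_nonneg p).trans hpρ))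
      have e : ε * inner ℝ (ε⁻¹ • σ x - p) (v - p) = inner ℝ (σ x) v - inner ℝ (σ x) p
          - ε * inner ℝ p v + ε * (‖p‖ * ‖p‖) := by
        rw [← real_inner_self_eq_norm_mul_norm]
        simp only [inner_sub_left, inner_sub_right, real_inner_smul_left]
        field_simp
        ring
      change ε * inner ℝ (ε⁻¹ • σ x - p) (v - p) ≤ _ at h2
      rw [e] at h2
      have h4 := mul_le_mul_of_nonneg_left h3 hε.le
      have h5 : 0 ≤ ε * (‖p‖ * ‖p‖) := by positivity
      linarith
    have h2 : inner ℝ (σ x) p ≤ inner ℝ (σ x) (P (ε⁻¹ • τ x)) + ε⁻¹ * ‖σ x - τ x‖ := by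
      have h3 := real_inner_le_norm (σ x) (p - P (ε⁻¹ • τ x))
      rw [hx, one_mul, inner_sub_right] at h3
      have h4 := hPlip (ε⁻¹ • σ x) (ε⁻¹ • τ x)
      rw [← smul_sub, norm_smul, Real.norm_of_nonneg (inv_pos.mpr hε).le] at h4
      linarith
    have h3 : inner ℝ (σ x) (P (ε⁻¹ • τ x)) ≤ inner ℝ (w x) (σ x) + ε := by
      have h4 := real_inner_le_norm (σ x) (P (ε⁻¹ • τ x) - w x)
      rw [hx, one_mul, inner_sub_right, norm_sub_rev] at h4
      rw [real_inner_comm (σ x) (w x)]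
      linarith [hwε x]
    linarith
  have hwi : Integrable (fun x => inner ℝ (w x) (σ x)) m := integrable_inner_of_memLp 1 ⊤
    (hw.smooth.continuous.memLp_of_hasCompactSupport hw.compact) hσ
  have hri : Integrable (fun x => ε⁻¹ * ‖σ x - τ x‖) m := (hσi.sub hτi).norm.const_mul _
  calc ∫ x, supportFun D (σ x) ∂m
      ≤ ∫ x, (inner ℝ (w x) (σ x) + ε * (ρ * ρ + 1) + ε⁻¹ * ‖σ x - τ x‖) ∂m :=
        integral_mono_ae (integrable_supportFun_comp ⟨0, h0⟩ hD h.measurable h.norm_eq_one)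
          ((hwi.add (integrable_const _)).add hri) hpt
    _ = ∫ x, inner ℝ (w x) (σ x) ∂m + m.real Set.univ * (ε * (ρ * ρ + 1))
          + ε⁻¹ * ∫ x, ‖σ x - τ x‖ ∂m := by
        have hwc : Integrable (fun x => inner ℝ (w x) (σ x) + ε * (ρ * ρ + 1)) m :=
          hwi.add (integrable_const _)
        rw [integral_add hwc hri, integral_add hwi (integrable_const _), integral_const, integral_const_mul, smul_eq_mul]
    _ ≤ c + m.real Set.univ * (ε * (ρ * ρ + 1)) + ε⁻¹ * (ε * ε) := by
        have := hc w hw hwD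
        rw [h.integral_by_parts w hw, neg_neg] at this
        gcongr
    _ = c + ε * A := by
        simp only [A]
        field_simp
        ring
    _ = c + η := by rw [div_mul_cancel₀ _ hA.ne']

/-! ### The bound of the total variation by the regularizer -/

/-- The map that subtracts from every row of a matrix the mean of this row. -/
noncomputable def centerRows (d l : ℕ) : Mat d l →L[ℝ] Mat d l :=
  LinearMap.toContinuousLinearMap
    { toFun := fun z => WithLp.toLp 2 fun p => z p - (∑ k, z (p.1, k)) / l
      map_add' := fun z w => by
        ext p
        simp only [PiLp.add_apply, Finset.sum_add_distrib]
        ring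
      map_smul' := fun c z => by
        ext p
        simp only [PiLp.smul_apply, smul_eq_mul, ← Finset.mul_sum, RingHom.id_apply]
        ring }

theorem centerRows_apply (z : Mat d l) (i : Fin d) (j : Fin l) :
    centerRows d l z (i, j) = z (i, j) - (∑ k, z (i, k)) / l := rfl

theorem sum_centerRows (hl : 1 ≤ l) (z : Mat d l) (i : Fin d) :
    ∑ j, centerRows d l z (i, j) = 0 := by
  have : (l : ℝ) ≠ 0 := by positivity
  simp only [centerRows_apply, Finset.sum_sub_distrib, Finset.sum_const, Finset.card_univ,
    Fintype.card_fin, nsmul_eq_mul]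
  field_simp
  ring

theorem inner_Div_eq (w : Labels l) (hw : ∑ j, w j = 1) {v : Space d → Mat d l}
    (hv : IsTestField v) (x : Space d) :
    inner ℝ w (Div v x) = inner ℝ w (Div (fun x => centerRows d l (v x)) x) +
      ∑ i, ∑ k, fderiv ℝ v x (EuclideanSpace.single i 1) (i, k) / l := by
  have h : ∀ j, Div v x j = Div (fun x => centerRows d l (v x)) x j +
      ∑ i, ∑ k, fderiv ℝ v x (EuclideanSpace.single i 1) (i, k) / l := fun j => by
    rw [Div_clm_comp hv]
    simp only [centerRows_apply, Finset.sum_sub_distrib, Finset.sum_div]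
    simp [Div]
  simp only [PiLp.inner_apply, h, RCLike.inner_apply, conj_trivial, add_mul,
    Finset.sum_add_distrib, ← Finset.mul_sum, hw, mul_one]

theorem integral_inner_Div_centerRows {u : Space d → Labels l}
    (hu : MemLp u 1 (volume.restrict (Omega d)))
    (hu1 : ∀ᵐ x ∂(volume.restrict (Omega d)), ∑ j, u x j = 1)
    {v : Space d → Mat d l} (hv : IsTestField v) :
    ∫ x in Omega d, inner ℝ (u x) (Div v x) =
      ∫ x in Omega d, inner ℝ (u x) (Div (fun x => centerRows d l (v x)) x) := by
  have hi : ∀ i k, Integrable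
      (fun x => fderiv ℝ v x (EuclideanSpace.single i 1) (i, k) / l)
      (volume.restrict (Omega d)) := fun i k =>
    (integrable_fderiv_apply hv _ _).restrict.div_const _
  rw [integral_congr_ae (hu1.mono fun x hx => inner_Div_eq (u x) hx hv x),
    integral_add (integrable_inner_Div hu (hv.clm_comp _))
      (integrable_finsetSum _ fun i _ => integrable_finsetSum _ fun k _ => hi i k),
    integral_finsetSum _ fun i _ => integrable_finsetSum _ fun k _ => hi i k]
  simp only [integral_finsetSum _ fun k _ => hi _ k, integral_div,
    integral_fderiv_apply_eq_zero hv, zero_div, Finset.sum_const_zero, add_zero]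

theorem exists_integral_inner_Div_le_mul_regularizer (hl : 1 ≤ l) {D : Set (Mat d l)} {ρl ρu : ℝ}
    (hρl : 0 < ρl)
    (h_inner : Metric.closedBall (0 : Mat d l) ρl ∩
      {v | ∀ i : Fin d, ∑ j : Fin l, v (i, j) = 0} ⊆ D)
    (h_outer : D ⊆ Metric.closedBall (0 : Mat d l) ρu) :
    ∃ K : ℝ, 0 ≤ K ∧ ∀ u ∈ feasible d l, ∀ v : Space d → Mat d l, IsTestField v →
      (∀ x ∈ Omega d, ‖v x‖ ≤ 1) →
      ∫ x in Omega d, inner ℝ (u x) (Div v x) ≤ K * regularizer D u := by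
  set A := centerRows d l
  set c := ρl / (‖A‖ + 1)
  have hc : 0 < c := by positivity
  refine ⟨c⁻¹, (inv_pos.mpr hc).le, fun u hu v hv hv1 => ?_⟩
  have hv1' : ∀ x, ‖v x‖ ≤ 1 := fun x => by
    by_cases hx : x ∈ Omega d
    · exact hv1 x hx
    · rw [hv.eq_zero hx, norm_zero]; exact zero_le_one
  have hAv := hv.clm_comp A
  have hwD : ∀ x, (-c • fun x => A (v x)) x ∈ D := fun x => by
    refine h_inner ⟨?_, fun i => ?_⟩
    · rw [mem_closedBall_zero_iff, Pi.smul_apply, norm_smul, norm_neg, Real.norm_of_nonneg hc.le]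
      have h1 : ‖A (v x)‖ ≤ ‖A‖ + 1 :=
        (A.le_opNorm_of_le (hv1' x)).trans (by rw [mul_one]; exact (lt_add_one _).le)
      calc c * ‖A (v x)‖ ≤ c * (‖A‖ + 1) := by gcongr
        _ = ρl := div_mul_cancel₀ _ (by positivity)
    · simp only [Pi.smul_apply, PiLp.smul_apply, smul_eq_mul, ← Finset.mul_sum]
      rw [sum_centerRows hl, mul_zero]
  have h := (isPolarGradient_polarGradient hu.1).neg_integral_le h_outer (hAv.smul (-c)) hwD
  rw [integral_inner_Div_centerRows hu.1.1 (hu.2.mono fun x hx => hx.2) hv, ← div_eq_inv_mul,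
    le_div_iff₀ hc]
  simp only [Div_smul hAv, inner_smul_right, integral_const_mul] at h
  change _ ≤ regularizer D u at h
  linarith

/-! ### Weak compactness -/

/-- Bounded sequences in a Hilbert space converge weakly along ultrafilters. -/
theorem exists_weak_limit_of_norm_le {H : Type*} [NormedAddCommGroup H] [InnerProductSpace ℝ H]
    [CompleteSpace H] {x : ℕ → H} {R : ℝ} (hx : ∀ n, ‖x n‖ ≤ R) (𝒰 : Ultrafilter ℕ) :
    ∃ y : H, ∀ h : H, Tendsto (fun n => (inner ℝ (x n) h : ℝ)) 𝒰 (𝓝 (inner ℝ y h)) := by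
  let f : ℕ → WeakDual ℝ H := fun n =>
    StrongDual.toWeakDual (InnerProductSpace.toDual ℝ H (x n))
  obtain ⟨ℓ, -, hℓ⟩ := (WeakDual.isCompact_closedBall (𝕜 := ℝ) (E := H) 0 R).ultrafilter_le_nhds
    (𝒰.map f) (by
      rw [le_principal_iff]
      refine mem_map.mpr (Eventually.of_forall fun n => ?_)
      change dist (InnerProductSpace.toDual ℝ H (x n)) 0 ≤ R
      rw [dist_zero_right]
      exact ((InnerProductSpace.toDual ℝ H).norm_map (x n)).trans_le (hx n))
  refine ⟨(InnerProductSpace.toDual ℝ H).symm (WeakDual.toStrongDual ℓ), fun h => ?_⟩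
  rw [InnerProductSpace.toDual_symm_apply]
  exact ((WeakDual.eval_continuous h).tendsto ℓ).comp hℓ

theorem norm_le_one_of_mem_stdSimplex {w : Labels l} (hw : w.ofLp ∈ stdSimplex ℝ (Fin l)) :
    ‖w‖ ≤ 1 := by
  rw [EuclideanSpace.norm_eq, Real.sqrt_le_one, ← hw.2]
  refine Finset.sum_le_sum fun i _ => ?_
  have h1 : w i ≤ 1 := hw.2 ▸ Finset.single_le_sum (fun j _ => hw.1 j) (Finset.mem_univ i)
  rw [Real.norm_of_nonneg (hw.1 i)]
  nlinarith [hw.1 i]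

section WeakLimit

variable {α : Type*} [MeasurableSpace α] {μ : Measure α}
  {F : Type*} [NormedAddCommGroup F] [InnerProductSpace ℝ F]

theorem ae_le_inner_of_tendsto [IsFiniteMeasure μ] {u : α → F} {un : ℕ → α → F} {𝒰 : Filter ℕ} [𝒰.NeBot]
    (hu : MemLp u 2 μ) (hun : ∀ n, MemLp (un n) 2 μ)
    (hlim : ∀ h, MemLp h 2 μ → Tendsto (fun n => ∫ x, (inner ℝ (un n x) (h x) : ℝ) ∂μ) 𝒰
      (𝓝 (∫ x, inner ℝ (u x) (h x) ∂μ)))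
    {e : F} {c : ℝ} (hc : ∀ n, ∀ᵐ x ∂μ, c ≤ inner ℝ (un n x) e) :
    ∀ᵐ x ∂μ, c ≤ inner ℝ (u x) e := by
  have hi : ∀ w, MemLp w 2 μ → Integrable (fun x => (inner ℝ (w x) e : ℝ)) μ := fun w hw =>
    (hw.integrable (by norm_num)).inner_const e
  have hind : ∀ w : α → F, ∀ s, MeasurableSet s →
      ∫ x, (inner ℝ (w x) (s.indicator (fun _ => e) x) : ℝ) ∂μ = ∫ x in s, inner ℝ (w x) e ∂μ := by
    intro w s hs
    rw [← integral_indicator hs]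
    congr 1 with x
    by_cases hx : x ∈ s <;> simp [hx]
  have h := ae_nonneg_of_forall_setIntegral_nonneg ((hi u hu).sub (integrable_const c))
    fun s hs _ => by
      have h1 := hlim (s.indicator fun _ => e) ((memLp_const e).indicator hs)
      simp only [hind _ s hs] at h1
      simp only [Pi.sub_apply]
      rw [integral_sub (hi u hu).integrableOn (integrable_const c).integrableOn, sub_nonneg]
      refine ge_of_tendsto' h1 fun n => ?_
      exact integral_mono_ae (integrable_const c).integrableOn (hi _ (hun n)).integrableOn
        (ae_restrict_of_ae (hc n))
  filter_upwards [h] with x hx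
  exact sub_nonneg.mp hx

theorem tendsto_integral_inner_of_bounded [TopologicalSpace α] [T2Space α] [NormalSpace α] [LocallyCompactSpace α]
    [BorelSpace α] [μ.Regular] {u : α → F} {un : ℕ → α → F} {𝒰 : Filter ℕ}
    (hu : MemLp u ⊤ μ) (hun : ∀ n, MemLp (un n) ⊤ μ)
    (hu1 : ∀ᵐ x ∂μ, ‖u x‖ ≤ 1) (hun1 : ∀ n, ∀ᵐ x ∂μ, ‖un n x‖ ≤ 1)
    (hlim : ∀ h, MemLp h 2 μ → Tendsto (fun n => ∫ x, (inner ℝ (un n x) (h x) : ℝ) ∂μ) 𝒰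
      (𝓝 (∫ x, inner ℝ (u x) (h x) ∂μ)))
    {h : α → F} (hh : MemLp h 1 μ) :
    Tendsto (fun n => ∫ x, (inner ℝ (un n x) (h x) : ℝ) ∂μ) 𝒰
      (𝓝 (∫ x, inner ℝ (u x) (h x) ∂μ)) := by
  have hhi := memLp_one_iff_integrable.mp hh
  rw [Metric.tendsto_nhds]
  intro ε hε
  obtain ⟨g, hgs, hgε, hgc, hgi⟩ :=
    hhi.exists_hasCompactSupport_integral_sub_le (ε := ε / 3) (by positivity)
  have hclose : ∀ w : α → F, MemLp w ⊤ μ → (∀ᵐ x ∂μ, ‖w x‖ ≤ 1) →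
      |∫ x, (inner ℝ (w x) (h x) : ℝ) ∂μ - ∫ x, inner ℝ (w x) (g x) ∂μ| ≤ ε / 3 := by
    intro w hw hw1
    rw [← integral_sub (integrable_inner_of_memLp ⊤ 1 hw hh)
      (integrable_inner_of_memLp ⊤ 1 hw (memLp_one_iff_integrable.mpr hgi)), ← Real.norm_eq_abs]
    refine (norm_integral_le_of_norm_le (hhi.sub hgi).norm ?_).trans hgε
    filter_upwards [hw1] with x hx
    rw [← inner_sub_right]
    exact (norm_inner_le_norm _ _).trans (mul_le_of_le_one_left (norm_nonneg _) hx)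
  have h2 := Metric.tendsto_nhds.mp (hlim g (hgc.memLp_of_hasCompactSupport hgs)) (ε / 3)
    (by positivity)
  filter_upwards [h2] with n hn
  rw [Real.dist_eq, abs_lt] at hn ⊢
  have h3 := abs_le.mp (hclose u hu hu1)
  have h4 := abs_le.mp (hclose _ (hun n) (hun1 n))
  constructor <;> linarith [h3.1, h3.2, h4.1, h4.2]

end WeakLimit

/-- Sequences of functions with values in the simplex have weak limits along ultrafilters. -/
theorem exists_weak_limit_of_mem_stdSimplex {un : ℕ → Space d → Labels l}
    (hun : ∀ n, MemLp (un n) 1 (volume.restrict (Omega d)))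
    (hS : ∀ n, ∀ᵐ x ∂(volume.restrict (Omega d)), (un n x).ofLp ∈ stdSimplex ℝ (Fin l))
    (𝒰 : Ultrafilter ℕ) :
    ∃ u : Space d → Labels l, MemLp u 1 (volume.restrict (Omega d)) ∧
      (∀ᵐ x ∂(volume.restrict (Omega d)), (u x).ofLp ∈ stdSimplex ℝ (Fin l)) ∧
      ∀ h, MemLp h 1 (volume.restrict (Omega d)) →
        Tendsto (fun n => ∫ x in Omega d, (inner ℝ (un n x) (h x) : ℝ)) 𝒰
          (𝓝 (∫ x in Omega d, inner ℝ (u x) (h x))) := by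
  set μ : Measure (Space d) := volume.restrict (Omega d)
  have hb : ∀ n, ∀ᵐ x ∂μ, ‖un n x‖ ≤ 1 := fun n =>
    (hS n).mono fun x hx => norm_le_one_of_mem_stdSimplex hx
  have htop : ∀ n, MemLp (un n) ⊤ μ := fun n => memLp_top_of_bound (hun n).1 1 (hb n)
  have h2 : ∀ n, MemLp (un n) 2 μ := fun n => (htop n).mono_exponent le_top
  obtain ⟨y, hy⟩ := exists_weak_limit_of_norm_le
    (x := fun n => (h2 n).toLp (un n)) (R := _)
    (fun n => Lp.norm_le_of_ae_bound (C := 1) zero_le_one (by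
      filter_upwards [(h2 n).coeFn_toLp, hb n] with x hx hx1
      rwa [hx])) 𝒰
  have hyL2 : MemLp y 2 μ := Lp.memLp y
  have hlim : ∀ h, MemLp h 2 μ → Tendsto (fun n => ∫ x, (inner ℝ (un n x) (h x) : ℝ) ∂μ) 𝒰
      (𝓝 (∫ x, inner ℝ (y x) (h x) ∂μ)) := fun h hh => by
    have key : ∀ (w : Lp (Labels l) 2 μ) (w' : Space d → Labels l), w =ᵐ[μ] w' →
        inner ℝ w (hh.toLp h) = ∫ x, (inner ℝ (w' x) (h x) : ℝ) ∂μ := fun w w' hw => by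
      rw [L2.inner_def]
      refine integral_congr_ae ?_
      filter_upwards [hw, hh.coeFn_toLp] with x hx hx'
      rw [hx, hx']
    have := hy (hh.toLp h)
    rw [key y y EventuallyEq.rfl] at this
    refine this.congr fun n => key _ _ (h2 n).coeFn_toLp
  have hhalf := fun (e : Labels l) (c : ℝ) => ae_le_inner_of_tendsto (e := e) (c := c) hyL2 h2 hlim
  have hone : ∀ w : Labels l, inner ℝ w (WithLp.toLp 2 fun _ => (1 : ℝ)) = ∑ j, w j := fun w => by
    simp [PiLp.inner_apply]
  have hnn : ∀ᵐ x ∂μ, ∀ j, 0 ≤ y x j := ae_all_iff.mpr fun j => by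
    have := hhalf (EuclideanSpace.single j 1) 0 fun n => (hS n).mono fun x hx => by
      simpa [EuclideanSpace.inner_single_right] using hx.1 j
    simpa [EuclideanSpace.inner_single_right] using this
  have hge : ∀ᵐ x ∂μ, 1 ≤ ∑ j, y x j := by
    have := hhalf (WithLp.toLp 2 fun _ => (1 : ℝ)) 1 fun n => (hS n).mono fun x hx => by
      rw [hone]; exact hx.2.ge
    simpa only [hone] using this
  have hle : ∀ᵐ x ∂μ, -1 ≤ -∑ j, y x j := by
    have := hhalf (-WithLp.toLp 2 fun _ => (1 : ℝ)) (-1) fun n => (hS n).mono fun x hx => by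
      rw [inner_neg_right, hone]; exact (congrArg Neg.neg hx.2).ge
    simpa only [inner_neg_right, hone] using this
  have hyS : ∀ᵐ x ∂μ, (y x).ofLp ∈ stdSimplex ℝ (Fin l) := by
    filter_upwards [hnn, hge, hle] with x h1 h2 h3
    exact ⟨h1, le_antisymm (neg_le_neg_iff.mp h3) h2⟩
  have hyb : ∀ᵐ x ∂μ, ‖y x‖ ≤ 1 := hyS.mono fun x hx => norm_le_one_of_mem_stdSimplex hx
  exact ⟨y, hyL2.mono_exponent (by norm_num), hyS, fun h hh =>
    tendsto_integral_inner_of_bounded (memLp_top_of_bound hyL2.1 1 hyb) htop hyb hb hlim hh⟩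

/-! ### Existence of minimizers -/

theorem feasible_nonempty (d : ℕ) (hl : 1 ≤ l) : (feasible d l).Nonempty := by
  let j : Fin l := ⟨0, hl⟩
  refine ⟨fun _ => EuclideanSpace.single j 1, ⟨memLp_const _, ?_⟩, ?_⟩
  · refine lt_of_le_of_lt (iSup_le fun v => ?_) EReal.zero_lt_top
    have hv := v.2.1
    have : ∫ x in Omega d, (inner ℝ (EuclideanSpace.single j (1 : ℝ)) (Div v.1 x) : ℝ) = 0 := by
      simp only [EuclideanSpace.inner_single_left, map_one, one_mul, Div]
      rw [integral_finsetSum _ fun i _ =>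
        (integrable_fderiv_apply hv (EuclideanSpace.single i 1) (i, j)).restrict]
      simp [integral_fderiv_apply_eq_zero hv]
    simp [this]
  · refine Eventually.of_forall fun x => ⟨fun i => ?_, ?_⟩
    · by_cases h : i = j <;> simp [h]
    · simp

theorem neg_integral_norm_le_integral_inner {u s : Space d → Labels l} (hu : u ∈ feasible d l)
    (hs : MemLp s 1 (volume.restrict (Omega d))) :
    -∫ x in Omega d, ‖s x‖ ≤ ∫ x in Omega d, inner ℝ (u x) (s x) := by
  refine neg_le_of_abs_le ?_
  rw [← Real.norm_eq_abs]
  refine norm_integral_le_of_norm_le (memLp_one_iff_integrable.mp hs).norm ?_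
  filter_upwards [hu.2] with x hx
  exact (norm_inner_le_norm (𝕜 := ℝ) (u x) (s x)).trans
    (mul_le_of_le_one_left (norm_nonneg _) (norm_le_one_of_mem_stdSimplex hx))

end Labeling

open Filter Topology in
theorem mainTheorem4 (d l : ℕ) (hd : 1 ≤ d) (hl : 1 ≤ l)
    (D : Set (Labeling.Mat d l)) (hD_ne : D.Nonempty) (hD_closed : IsClosed D)
    (hD_convex : Convex ℝ D)
    (ρl ρu : ℝ) (hρl : 0 < ρl) (hρ : ρl ≤ ρu)
    (h_inner : Metric.closedBall (0 : Labeling.Mat d l) ρl ∩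
      {v | ∀ i : Fin d, ∑ j : Fin l, v (i, j) = 0} ⊆ D)
    (h_outer : D ⊆ Metric.closedBall (0 : Labeling.Mat d l) ρu)
    (s : Labeling.Space d → Labeling.Labels l)
    (hs : MemLp s 1 (volume.restrict (Labeling.Omega d))) :
    ∃ u ∈ Labeling.feasible d l,
      ∀ w ∈ Labeling.feasible d l, Labeling.objective D s u ≤ Labeling.objective D s w := by
  have h0 : (0 : Labeling.Mat d l) ∈ D := h_inner ⟨by simpa using hρl.le, by simp⟩
  obtain ⟨K, hK, hTV⟩ :=
    Labeling.exists_integral_inner_Div_le_mul_regularizer hl hρl h_inner h_outer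
  have hbdd : BddBelow (Labeling.objective D s '' Labeling.feasible d l) := by
    refine ⟨-∫ x in Labeling.Omega d, ‖s x‖, ?_⟩
    rintro _ ⟨u, hu, rfl⟩
    have h1 : 0 ≤ Labeling.regularizer D u :=
      integral_nonneg fun x => Labeling.supportFun_nonneg h_outer h0 _
    have h2 := Labeling.neg_integral_norm_le_integral_inner hu hs
    rw [Labeling.objective]
    linarith
  obtain ⟨a, -, ha, haS⟩ := exists_seq_tendsto_sInf ((Labeling.feasible_nonempty d hl).image _) hbdd
  set I := sInf (Labeling.objective D s '' Labeling.feasible d l)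
  choose un hun hobj using haS
  have hobj_lim : Tendsto (fun n => Labeling.objective D s (un n)) (hyperfilter ℕ) (𝓝 I) := by
    simp only [hobj]
    exact ha.mono_left Nat.hyperfilter_le_atTop
  obtain ⟨u, hu1, huS, hlim⟩ := Labeling.exists_weak_limit_of_mem_stdSimplex
    (fun n => (hun n).1.1) (fun n => (hun n).2) (hyperfilter ℕ)
  have hTVu : Labeling.TV u ≤ ((K * (I + 1 + ∫ x in Labeling.Omega d, ‖s x‖) : ℝ) : EReal) := by
    refine iSup_le fun v => EReal.coe_le_coe_iff.mpr ?_
    refine le_of_tendsto (hlim _ (Labeling.memLp_Div v.2.1 1)) ?_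
    filter_upwards [hobj_lim.eventually (gt_mem_nhds (lt_add_one I))] with n hn
    refine (hTV _ (hun n) v.1 v.2.1 v.2.2).trans (mul_le_mul_of_nonneg_left ?_ hK)
    have h2 := Labeling.neg_integral_norm_le_integral_inner (hun n) hs
    rw [Labeling.objective] at hn
    linarith
  have hu : u ∈ Labeling.feasible d l := ⟨⟨hu1, hTVu.trans_lt (EReal.coe_lt_top _)⟩, huS⟩
  refine ⟨u, hu, fun w hw => le_trans ?_ (csInf_le hbdd ⟨w, hw, rfl⟩)⟩
  have hreg : Labeling.regularizer D u ≤ I - ∫ x in Labeling.Omega d, inner ℝ (u x) (s x) := by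
    refine (Labeling.isPolarGradient_polarGradient hu.1).integral_supportFun_le hD_closed hD_convex
      h0 h_outer fun v hv hvD => ?_
    rw [le_sub_iff_add_le]
    refine le_of_tendsto_of_tendsto' ((hlim _ (Labeling.memLp_Div hv 1)).neg.add (hlim s hs))
      hobj_lim fun n => ?_
    have := (Labeling.isPolarGradient_polarGradient (hun n).1).neg_integral_le h_outer hv hvD
    rw [Labeling.objective, Labeling.regularizer, add_comm]
    linarith
  rw [Labeling.objective]
  linarith
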